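/- All graphs are finite and simple. Let $d\ge 1$. A framework $(G,p)$ in $\mathbb{C}^d$ is a graph $G=(V,E)$ with a map $p:V\to\mathbb{C}^d$; it is generic if the $d|V|$ coordinates of $p$ are algebraically independent over $\mathbb{Q}$. The complex squared length of a pair $uv$ of vertices in $(G,p)$ is $m_{uv}(p)=\sum_{k=1}^d(p(u)_k-p(v)_k)^2$. The graph $G$ is rigid in $\mathbb{C}^d$ if for every generic $p$ and every continuous map $t\mapsto p_t\in(\mathbb{C}^d)^V$, $t\in[0,1]$, with $p_0=p$ and $m_{uv}(p_t)=m_{uv}(p)$ for all $uv\in E$ and all $t$, we have $m_{uv}(p_t)=m_{uv}(p)$ for all $u,v\in V$ and all $t$. The graph $G$ is fully reconstructible in $\mathbb{C}^d$ if it has no isolated vertices and the following holds for every generic framework $(G,p)$ in $\mathbb{C}^d$: whenever $H$ is a graph without isolated vertices (on any number of vertices), $(H,q)$ is a generic framework in $\mathbb{C}^d$ and $\psi:E(G)\to E(H)$ is a bijection such that every edge $e$ of $G$ has the same complex squared length in $(G,p)$ as $\psi(e)$ has in $(H,q)$, there is a graph isomorphism $\varphi:V(G)\to V(H)$ with $\psi(uv)=\varphi(u)\varphi(v)$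 for all $uv\in E(G)$. Theorem. Let $d\ge 1$ and let $G=(V,E)$ be a graph that is the union of two induced subgraphs $G_1=(V_1,E_1)$ and $G_2=(V_2,E_2)$, that is, $V=V_1\cup V_2$ and $E=E_1\cup E_2$. Suppose that $V_1\cap V_2$ induces a connected subgraph of $G$ on at least three vertices. If $G_1$ and $G_2$ each have at least $d+1$ vertices and are rigid and fully reconstructible in $\mathbb{C}^d$, then $G$ is fully reconstructible in $\mathbb{C}^d$. -/

import Mathlib

namespace Rigidity

/-- A configuration: a placement of the vertices in `ℂ^d`. A graph on `V` together with a
configuration is a (complex) framework. -/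
abbrev Config (V : Type*) (d : ℕ) : Type _ := V → Fin d → ℂ

/-- The complex squared length of a pair of vertices (no conjugation is involved). -/
noncomputable def sqLength {V : Type*} {d : ℕ} (p : Config V d) : Sym2 V → ℂ :=
  Sym2.lift ⟨fun u v => ∑ k, (p u k - p v k) ^ 2, fun _ _ =>
    Finset.sum_congr rfl fun _ _ => by ring⟩

/-- A configuration is generic if all of its coordinates together are algebraically independent
over `ℚ`. -/
def Generic {V : Type*} {d : ℕ} (p : Config V d) : Prop :=
  AlgebraicIndependent ℚ (fun x : V × Fin d => p x.1 x.2)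

/-- The frameworks `(G, p)` and `(G, q)` are equivalent: corresponding edges have the same
complex squared length. -/
def Equivalent {V : Type*} {d : ℕ} (G : SimpleGraph V) (p q : Config V d) : Prop :=
  ∀ e ∈ G.edgeSet, sqLength p e = sqLength q e

/-- Congruence of configurations: all pairs of vertices have the same complex squared length,
that is, the configurations give equivalent frameworks of the complete graph. -/
def Congruent {V : Type*} {d : ℕ} (p q : Config V d) : Prop :=
  Equivalent (⊤ : SimpleGraph V) p q

/-- The framework `(G, p)` is (locally) rigid in `ℂ^d`: every continuous motion of the vertices
that starts at `p` and preserves the edge lengths takes `p` to congruent configurations. -/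
def FrameworkRigid {V : Type*} {d : ℕ} (G : SimpleGraph V) (p : Config V d) : Prop :=
  ∀ γ : unitInterval → Config V d, Continuous γ → γ 0 = p →
    (∀ t, Equivalent G p (γ t)) → ∀ t, Congruent p (γ t)

/-- A graph is rigid in `ℂ^d` if every generic realization of it in `ℂ^d` is rigid. -/
def Rigid {V : Type*} (d : ℕ) (G : SimpleGraph V) : Prop :=
  ∀ p : Config V d, Generic p → FrameworkRigid G p

/-- The graph has no isolated vertices. -/
def NoIsolated {V : Type*} (G : SimpleGraph V) : Prop :=
  ∀ v, ¬ G.IsIsolated v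

/-- The frameworks `(G, p)` and `(H, q)` are length-equivalent under the edge bijection `ψ`. -/
def LengthEquivalent {V W : Type*} {d : ℕ} {G : SimpleGraph V} {H : SimpleGraph W}
    (p : Config V d) (q : Config W d) (ψ : G.edgeSet ≃ H.edgeSet) : Prop :=
  ∀ e : G.edgeSet, sqLength p e = sqLength q (ψ e)

/-- The framework `(G, p)` is fully reconstructible (a notion for generic `p` and for `G` without
isolated vertices): whenever a generic framework `(H, q)` in `ℂ^d`, where `H` is a finite graph
without isolated vertices, is length-equivalent to `(G, p)` under an edge bijection `ψ`, there is
a graph isomorphism from `G` to `H` that induces `ψ`. The number of vertices of `H` is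
arbitrary. Every finite graph is isomorphic to one whose vertex set is in `Type`. -/
def FrameworkFullyReconstructible {V : Type*} {d : ℕ} (G : SimpleGraph V) (p : Config V d) :
    Prop :=
  ∀ (W : Type) [Finite W] (H : SimpleGraph W) (q : Config W d) (ψ : G.edgeSet ≃ H.edgeSet),
    NoIsolated H → Generic q → LengthEquivalent p q ψ →
      ∃ φ : G ≃g H, ∀ e : G.edgeSet, ψ e = φ.mapEdgeSet e

/-- A graph is (generically) fully reconstructible in `ℂ^d` if it has no isolated vertices and
every generic realization of it in `ℂ^d` is fully reconstructible. -/
def FullyReconstructible {V : Type*} (d : ℕ) (G : SimpleGraph V) : Prop :=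
  NoIsolated G ∧ ∀ p : Config V d, Generic p → FrameworkFullyReconstructible G p

end Rigidity

/-!
Let `(G, p)` and `(H, q)` be generic and length-equivalent under `ψ`. Full reconstructibility of
`G₁` and `G₂`, applied to the subgraphs of `H` formed by the images of their edges, gives injective
maps `φ₁`, `φ₂` on their vertex sets `V₁`, `V₂` that induce `ψ` (`exists_map_of_subgraph`). In a
connected graph on at least three vertices the images of the edges determine the images of the
vertices (`eq_of_forall_adj_sym2_eq`), so `φ₁` and `φ₂` agree on `V₁ ∩ V₂` and glue to a surjective
map `φ : V → V(H)` that induces `ψ`. What remains is that `φ` is injective: a vertex `u` of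
`V₁ \ V₂` must not be identified with a vertex of `V₂ \ V₁`. This is where rigidity and genericity
are used.

Let `cl` be algebraic closure over `ℚ` in `ℂ`, the closure operator of the algebraic independence
matroid, and let `L_r(S)` be the set of squared lengths of all pairs of vertices in `S` for a
configuration `r`.

* If a generic framework is rigid, then every squared length lies in `cl` of the edge lengths
  (`FrameworkRigid.pairLengths_subset`): a length that is algebraically independent of the
  edge lengths can be varied along a path that keeps a transcendence basis of the edge lengths
  constant, by the inverse function theorem, and the remaining edge lengths stay constant because
  they take finitely many values. Hence `L_q(φ(Vᵢ)) ⊆ cl L_p(Vᵢ)` for `i = 1, 2`.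
* `cl L_p(V₁) ∩ cl L_p(V₂) ⊆ cl L_p(V₁ ∩ V₂)` for generic `p`
  (`Generic.closure_pairLengths_inter_subset`). Membership in `cl` is tested by derivations of `ℂ`.
  A derivation that kills `L_p(V₁ ∩ V₂)` gives an infinitesimal motion of these points that keeps
  all their distances, which by genericity is an infinitesimal isometry. Replacing the velocities
  on `V₁` by this isometry gives a derivation that kills `L_p(V₁)` and is unchanged on `V₂`, so
  both derivations kill the intersection on the left.
* If `φ u` is also the image of a vertex of `V₂`, then the length between `φ u` and `φ v`, for
  `v ∈ V₁ ∩ V₂`, and all of `L_q(φ(V₁ ∩ V₂))` lie in `cl L_p(V₁ ∩ V₂)`. That length is not in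
  `cl L_q(φ(V₁ ∩ V₂))`, whereas `L_p(V₁ ∩ V₂)` and `L_q(φ(V₁ ∩ V₂))` have the same finite rank, as
  the same polynomials evaluated at generic points: a contradiction.
-/

namespace Rigidity

open AlgebraicIndependent (matroid)

/-! ### Derivations and algebraic closure -/

section Derivations

variable {k K : Type*} [Field k] [Field K] [Algebra k K]

open TensorProduct in
/-- `K` is formally étale over the polynomial ring on a transcendence basis, being a separable
algebraic extension of its field of fractions, so derivations of that ring extend to `K`. -/
theorem exists_derivation_of_isTranscendenceBasis [CharZero k] {ι : Type*} {x : ι → K}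
    (hx : IsTranscendenceBasis k x) (w : ι → K) :
    ∃ D : Derivation k K K, ∀ i, D (x i) = w i := by
  let f := MvPolynomial.aeval (R := k) x
  let : Algebra (MvPolynomial ι k) K := f.toRingHom.toAlgebra
  have : IsScalarTower k (MvPolynomial ι k) K := .of_algHom f
  have hf : Function.Injective (algebraMap (MvPolynomial ι k) K) := hx.1
  have : FaithfulSMul (MvPolynomial ι k) K := (faithfulSMul_iff_algebraMap_injective _ _).2 hf
  let F := FractionRing (MvPolynomial ι k)
  let : Algebra F K := FractionRing.liftAlgebra _ _
  have : Algebra.IsAlgebraic (MvPolynomial ι k) K := by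
    have := hx.isAlgebraic
    exact .of_ringHom_of_comp_eq (hx.1.aevalEquiv.toAlgHom.toRingHom) (RingHom.id K)
      hx.1.aevalEquiv.surjective Function.injective_id
      (RingHom.ext fun p ↦ hx.1.algebraMap_aevalEquiv p)
  have : Algebra.IsAlgebraic F K := .extendScalars (IsFractionRing.injective (MvPolynomial ι k) F)
  have : Algebra.FormallyEtale F K := .of_isSeparable F K
  have : Algebra.FormallyEtale (MvPolynomial ι k) F :=
    .of_isLocalization (nonZeroDivisors (MvPolynomial ι k))
  have : Algebra.FormallyEtale (MvPolynomial ι k) K := .comp _ F _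
  let e := KaehlerDifferential.tensorKaehlerEquivOfFormallyEtale k (MvPolynomial ι k) K
  let d₀ : Derivation k (MvPolynomial ι k) K := MvPolynomial.mkDerivation k w
  let l : K ⊗[MvPolynomial ι k] Ω[MvPolynomial ι k⁄k] →ₗ[K] K :=
    d₀.liftKaehlerDifferential.liftBaseChange K
  refine ⟨(l ∘ₗ e.symm.toLinearMap).compDer (KaehlerDifferential.D k K), fun i ↦ ?_⟩
  have hi : x i = algebraMap (MvPolynomial ι k) K (.X i) := (MvPolynomial.aeval_X x i).symm
  simp [hi, e, l, d₀, KaehlerDifferential.tensorKaehlerEquivOfFormallyEtale_symm_D_algebraMap]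

theorem exists_derivation_of_algebraicIndependent [CharZero k] {ι : Type*} {x : ι → K}
    (hx : AlgebraicIndependent k x) (w : ι → K) :
    ∃ D : Derivation k K K, ∀ i, D (x i) = w i := by
  obtain ⟨t, hst, ht⟩ := exists_isTranscendenceBasis_superset hx.to_subtype_range
  obtain ⟨D, hD⟩ := exists_derivation_of_isTranscendenceBasis ht
    (fun y ↦ Function.extend x w 0 y)
  exact ⟨D, fun i ↦ (hD ⟨x i, hst ⟨i, rfl⟩⟩).trans (hx.injective.extend_apply w 0 i)⟩

theorem mem_closure_iff_isAlgebraic {s : Set K} {a : K} :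
    a ∈ (matroid k K).closure s ↔ IsAlgebraic (Algebra.adjoin k s) a := by
  rw [AlgebraicIndependent.matroid_closure_eq]; rfl

theorem derivation_eq_zero_of_mem_closure [CharZero k] (D : Derivation k K K) {s : Set K}
    (hs : ∀ b ∈ s, D b = 0) {a : K} (ha : a ∈ (matroid k K).closure s) : D a = 0 := by
  let F := IntermediateField.adjoin k s
  have h0 : ∀ b ∈ F, D b = 0 := fun b hb ↦ by
    induction hb using IntermediateField.adjoin_induction with
    | mem x hx => exact hs x hx
    | algebraMap x => simp
    | add x y _ _ hx hy => simp [hx, hy]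
    | inv x _ hx => simp [Derivation.leibniz_inv, hx]
    | mul x y _ _ hx hy => simp [hx, hy]
  rw [mem_closure_iff_isAlgebraic] at ha
  have ha : IsAlgebraic F a := ha.tower_top_of_subalgebra_le
    (B := F.toSubalgebra) (IntermediateField.algebra_adjoin_le_adjoin k s)
  let D' : Derivation F K K := .mk'
    { toFun := D
      map_add' := map_add D
      map_smul' := fun r b ↦ by
        rw [Algebra.smul_def, D.leibniz, IntermediateField.algebraMap_apply, h0 r r.2]
        simp [Algebra.smul_def] } (fun b c ↦ D.leibniz b c)
  have h1 := D'.map_aeval (minpoly F a) a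
  rw [minpoly.aeval, map_zero] at h1
  have h2 : Polynomial.aeval a (Polynomial.derivative (minpoly F a)) ≠ 0 :=
    (minpoly.irreducible ha.isIntegral).separable.aeval_derivative_ne_zero (minpoly.aeval F a)
  exact (smul_eq_zero.1 h1.symm).resolve_left h2

theorem exists_derivation_of_notMem_closure [CharZero k] {s : Set K} {a : K}
    (ha : a ∉ (matroid k K).closure s) :
    ∃ D : Derivation k K K, (∀ b ∈ s, D b = 0) ∧ D a ≠ 0 := by
  classical
  obtain ⟨I, hI⟩ := (matroid k K).exists_isBasis s
  rw [← hI.closure_eq_closure] at ha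
  have haI : a ∉ I := fun h ↦ ha ((matroid k K).mem_closure_of_mem h)
  have hind := (hI.indep.insert_indep_iff_of_notMem haI).2 ⟨trivial, ha⟩
  obtain ⟨D, hD⟩ := exists_derivation_of_algebraicIndependent
    (AlgebraicIndependent.matroid_indep_iff.1 hind) (fun y ↦ if y.1 = a then 1 else 0)
  refine ⟨D, fun b hb ↦ derivation_eq_zero_of_mem_closure D (s := I) (fun c hc ↦ ?_) ?_, ?_⟩
  · exact (hD ⟨c, by simp [hc]⟩).trans (if_neg (ne_of_mem_of_not_mem hc haI))
  · exact hI.subset_closure hb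
  · exact (hD ⟨a, by simp⟩).trans_ne (by simp)

/-- The algebraic rank of the values of a family of polynomials is largest at a generic point. -/
theorem eRk_range_aeval_le {σ E : Type*} (f : E → MvPolynomial σ k) {x y : σ → K}
    (hy : AlgebraicIndependent k y) :
    (matroid k K).eRk (Set.range fun e ↦ MvPolynomial.aeval x (f e)) ≤
      (matroid k K).eRk (Set.range fun e ↦ MvPolynomial.aeval y (f e)) := by
  obtain ⟨I, hI⟩ := (matroid k K).exists_isBasis (Set.range fun e ↦ MvPolynomial.aeval x (f e))
  choose e he using fun i : I ↦ hI.subset i.2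
  have hx : AlgebraicIndependent k fun i : I ↦ MvPolynomial.aeval x (f (e i)) := by
    have := AlgebraicIndependent.matroid_indep_iff.1 hI.indep
    simp only at he
    simp only [he]
    exact this
  have hy' : AlgebraicIndependent k fun i : I ↦ MvPolynomial.aeval y (f (e i)) :=
    (AlgebraicIndependent.of_comp (x := fun i ↦ f (e i)) (MvPolynomial.aeval x) hx).map'
      (f := MvPolynomial.aeval y) hy
  have : (matroid k K).Indep (Set.range fun i : I ↦ MvPolynomial.aeval y (f (e i))) :=
    AlgebraicIndependent.matroid_indep_iff.2 hy'.to_subtype_range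
  calc (matroid k K).eRk (Set.range fun e ↦ MvPolynomial.aeval x (f e))
      = I.encard := hI.eRk_eq_encard.symm ▸ rfl
    _ = (Set.range fun i : I ↦ MvPolynomial.aeval y (f (e i))).encard := by
      rw [← Set.image_univ, hy'.injective.encard_image, Set.encard_univ]; rfl
    _ ≤ _ := this.eRk_eq_encard ▸
      (matroid k K).eRk_mono (by rintro _ ⟨i, rfl⟩; exact ⟨e i, rfl⟩)

end Derivations

/-! ### Skew-symmetric matrices with prescribed values -/

/-- An infinitesimal motion `w` of the vectors `u` that preserves all their inner products is
skew-symmetric, provided that `u` is linearly independent or spans the space. (Otherwise `w` need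
not even respect the linear relations among the vectors `u`.) -/
theorem exists_skew_map {ι n : Type*} [Fintype n] {F : Type*} [Field F] [NeZero (2 : F)]
    (u w : ι → n → F)
    (huw : ∀ i j, w i ⬝ᵥ u j + u i ⬝ᵥ w j = 0)
    (hu : LinearIndependent F u ∨ Submodule.span F (Set.range u) = ⊤) :
    ∃ A : Matrix n n F, (∀ x, x ⬝ᵥ A.mulVec x = 0) ∧
      ∀ i, A.mulVec (u i) = w i := by
  classical
  let Lu := Finsupp.linearCombination F u
  let Lw := Finsupp.linearCombination F w
  have hskew : ∀ a b, Lw a ⬝ᵥ Lu b + Lu a ⬝ᵥ Lw b = 0 := fun a b ↦ by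
    induction a using Finsupp.induction_linear with
    | zero => simp
    | add a₁ a₂ h₁ h₂ =>
      simp only [map_add, add_dotProduct]
      linear_combination h₁ + h₂
    | single i r =>
      induction b using Finsupp.induction_linear with
      | zero => simp
      | add b₁ b₂ h₁ h₂ =>
        simp only [map_add, dotProduct_add]
        linear_combination h₁ + h₂
      | single j s =>
        simp only [Lu, Lw, Finsupp.linearCombination_single, smul_dotProduct, dotProduct_smul,
          smul_eq_mul]
        linear_combination r * s * huw i j
  -- `w` respects the linear relations among the vectors `u`
  have hker : LinearMap.ker Lu ≤ LinearMap.ker Lw := by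
    rcases hu with hu | hu
    · rw [LinearIndependent] at hu
      rw [LinearMap.ker_eq_bot.2 hu]; exact bot_le
    · intro a ha
      refine dotProduct_eq_zero _ fun v ↦ ?_
      obtain ⟨b, rfl⟩ : ∃ b, Lu b = v := by
        rw [← LinearMap.mem_range, Finsupp.range_linearCombination, hu]; trivial
      simpa [LinearMap.mem_ker.1 ha] using hskew a b
  obtain ⟨W, hW⟩ := ((LinearMap.ker Lu).liftQ Lw hker ∘ₗ
    Lu.quotKerEquivRange.symm.toLinearMap).exists_extend
  -- `P` is a projection onto the span of `u`
  obtain ⟨P, hP⟩ := (LinearMap.id : LinearMap.range Lu →ₗ[F] _).exists_extend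
  have hWu : ∀ a, W (Lu a) = Lw a := fun a ↦ by
    refine (LinearMap.congr_fun hW (Lu.quotKerEquivRange (Submodule.Quotient.mk a))).trans ?_
    simp only [LinearMap.comp_apply, LinearEquiv.coe_coe, LinearEquiv.symm_apply_apply]
    rfl
  have hPu : ∀ a, (P (Lu a) : n → F) = Lu a := fun a ↦
    congrArg Subtype.val (LinearMap.congr_fun hP ⟨Lu a, a, rfl⟩)
  let p : (n → F) →ₗ[F] (n → F) := (LinearMap.range Lu).subtype ∘ₗ P
  let q : (n → F) →ₗ[F] (n → F) := W ∘ₗ p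
  have hq : ∀ x y, q x ⬝ᵥ p y + p x ⬝ᵥ q y = 0 := fun x y ↦ by
    obtain ⟨a, ha⟩ := (P x).2
    obtain ⟨b, hb⟩ := (P y).2
    simp [q, p, ← ha, ← hb, hWu, hskew]
  -- The matrix `Q` maps `u` to `w` and vanishes on the kernel of the projection `R`. Subtracting
  -- `Qᵀ + Rᵀ Q`, which vanishes on the span of `u`, makes it skew-symmetric.
  let Q := LinearMap.toMatrix' q
  let R := LinearMap.toMatrix' p
  have hQ : ∀ x, Q.mulVec x = q x := fun x ↦ LinearMap.toMatrix'_mulVec q x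
  have hR : ∀ x, R.mulVec x = p x := fun x ↦ LinearMap.toMatrix'_mulVec p x
  have htr : ∀ (M : Matrix n n F) (x y), x ⬝ᵥ M.transpose.mulVec y = M.mulVec x ⬝ᵥ y :=
    fun M x y ↦ by rw [Matrix.dotProduct_mulVec, Matrix.vecMul_transpose]
  have hA : ∀ x y, x ⬝ᵥ (Q - Q.transpose - R.transpose * Q).mulVec y =
      x ⬝ᵥ q y - q x ⬝ᵥ y - p x ⬝ᵥ q y := fun x y ↦ by
    simp only [Matrix.sub_mulVec, ← Matrix.mulVec_mulVec, dotProduct_sub, htr, hQ, hR]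
  refine ⟨Q - Q.transpose - R.transpose * Q, fun x ↦ ?_, fun i ↦ ?_⟩
  · have := hq x x
    rw [hA, dotProduct_comm x (q x)]
    rw [dotProduct_comm (q x) (p x)] at this
    have h0 : p x ⬝ᵥ q x = 0 := by
      rw [← two_mul] at this
      exact (mul_eq_zero.1 this).resolve_left two_ne_zero
    linear_combination -h0
  · have hi : Lu (.single i 1) = u i := by simp [Lu]
    have hpi : p (u i) = u i := by simp [p, ← hi, hPu]
    have hqi : q (u i) = w i := by
      have : q (u i) = W (p (u i)) := rfl
      rw [this, hpi, ← hi, hWu]; simp [Lw]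
    rw [← sub_eq_zero]
    refine dotProduct_eq_zero _ fun x ↦ ?_
    have := hq x (u i)
    rw [hpi, hqi] at this
    rw [dotProduct_comm, dotProduct_sub, hA, hqi]
    linear_combination -this

/-! ### Motions along which polynomials are constant -/

/-- If `f` has surjective derivative at `x`, then a short segment from `f x` in any direction `c`
lifts to a path that starts at `x`. -/
theorem exists_path_of_surjective_deriv {E F : Type*} [NormedAddCommGroup E] [NormedSpace ℂ E]
    [NormedAddCommGroup F] [NormedSpace ℂ F] [FiniteDimensional ℂ F]
    {f : E → F} {f' : E →L[ℂ] F} {x : E} (hf : HasStrictFDerivAt f f' x)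
    (hf' : Function.Surjective f') (c : F) :
    ∃ γ : unitInterval → E, Continuous γ ∧ γ 0 = x ∧
      ∃ r : ℂ, r ≠ 0 ∧ ∀ t : unitInterval, f (γ t) = f x + (((t : ℝ) : ℂ) * r) • c := by
  have : CompleteSpace F := FiniteDimensional.complete ℂ F
  obtain ⟨R₀, hR₀⟩ := (f' : E →ₗ[ℂ] F).exists_rightInverse_of_surjective
    (LinearMap.range_eq_top.2 hf')
  let R : F →L[ℂ] E := LinearMap.toContinuousLinearMap R₀
  have hR : ∀ y, f' (R y) = y := fun y ↦ LinearMap.congr_fun hR₀ y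
  -- `f` restricted to the range of a right inverse of `f'` has derivative the identity at `0`
  let g : F → F := fun y ↦ f (x + R y)
  have hg : HasStrictFDerivAt g ((ContinuousLinearEquiv.refl ℂ F : F ≃L[ℂ] F) : F →L[ℂ] F) 0 := by
    have h1 : HasStrictFDerivAt (fun y ↦ x + R y) R 0 := R.hasStrictFDerivAt.const_add x
    have h2 : HasStrictFDerivAt f f' (x + R 0) := by simpa using hf
    convert h2.comp 0 h1 using 1
    ext y; simp [hR]
  let e := hg.toOpenPartialHomeomorph g
  have hg0 : g 0 = f x := by simp [g]
  have h0 : f x ∈ e.target := hg0 ▸ hg.image_mem_toOpenPartialHomeomorph_target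
  obtain ⟨ε, hε, hball⟩ := Metric.isOpen_iff.1 e.open_target _ h0
  let r : ℝ := ε / (2 * (‖c‖ + 1))
  have hr : 0 < r := by positivity
  let δ : unitInterval → F := fun t ↦ f x + (((t : ℝ) : ℂ) * r) • c
  have hδ : ∀ t, δ t ∈ e.target := fun t ↦ hball <| by
    have hrc : r * ‖c‖ < ε := by
      have : r * (2 * (‖c‖ + 1)) = ε := div_mul_cancel₀ _ (by positivity)
      nlinarith [norm_nonneg c]
    have h1 : |(t : ℝ)| ≤ 1 := by rw [abs_of_nonneg t.2.1]; exact t.2.2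
    simp only [δ, Metric.mem_ball, dist_self_add_left, norm_smul, norm_mul, Complex.norm_real,
      Real.norm_eq_abs, abs_of_pos hr]
    calc |(t : ℝ)| * r * ‖c‖ ≤ 1 * r * ‖c‖ := by gcongr
      _ < ε := by rwa [one_mul]
  have hδc : Continuous δ := by fun_prop
  have hs0 : e.symm (f x) = 0 := by
    rw [← hg0]; exact e.left_inv hg.mem_toOpenPartialHomeomorph_source
  refine ⟨fun t ↦ x + R (e.symm (δ t)), ?_, ?_, r, by exact_mod_cast hr.ne', fun t ↦ ?_⟩
  · exact continuous_const.add (R.continuous.comp (e.continuousOn_symm.comp_continuous hδc hδ))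
  · simp [δ, hs0]
  · exact e.right_inv (hδ t)

theorem hasStrictFDerivAt_aeval {σ : Type*} [Fintype σ] (f : MvPolynomial σ ℚ) (x : σ → ℂ) :
    HasStrictFDerivAt (fun z : σ → ℂ ↦ MvPolynomial.aeval z f)
      (∑ i, MvPolynomial.aeval x (MvPolynomial.pderiv i f) •
        ContinuousLinearMap.proj (R := ℂ) (φ := fun _ : σ ↦ ℂ) i) x := by
  classical
  induction f using MvPolynomial.induction_on with
  | C a =>
    refine ((hasStrictFDerivAt_const (algebraMap ℚ ℂ a) x).congr_fderiv ?_).congr_of_eventuallyEq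
      (.of_forall fun z ↦ by simp)
    ext v; simp
  | add p q hp hq =>
    refine ((hp.add hq).congr_fderiv ?_).congr_of_eventuallyEq (.of_forall fun z ↦ by simp)
    ext v; simp [add_mul, Finset.sum_add_distrib]
  | mul_X p i hp =>
    refine ((hp.mul (ContinuousLinearMap.proj (R := ℂ) (φ := fun _ : σ ↦ ℂ)
      i).hasStrictFDerivAt).congr_fderiv ?_).congr_of_eventuallyEq (.of_forall fun z ↦ by simp)
    ext v
    simp [Pi.single_apply, add_mul, mul_assoc, Finset.sum_add_distrib, Finset.mul_sum,
      apply_ite]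

theorem derivation_aeval {σ k K : Type*} [Fintype σ] [Field k] [Field K] [Algebra k K]
    (D : Derivation k K K) (f : MvPolynomial σ k) (x : σ → K) :
    D (MvPolynomial.aeval x f) =
      ∑ i, MvPolynomial.aeval x (MvPolynomial.pderiv i f) * D (x i) := by
  classical
  induction f using MvPolynomial.induction_on with
  | C a => simp
  | add p q hp hq => simp [hp, hq, add_mul, Finset.sum_add_distrib]
  | mul_X p i hp =>
    simp [hp, Pi.single_apply, add_mul, mul_assoc, Finset.sum_add_distrib, Finset.mul_sum,
      apply_ite]

/-- Along a path from a generic point on which the polynomials `f` are constant, a polynomial `g`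
is constant if its value at the generic point is algebraic over those of `f`: by genericity the
algebraic relation holds identically, so `g` takes finitely many values on the path. -/
theorem aeval_path_constant {σ E : Type*} {f : E → MvPolynomial σ ℚ} {x : σ → ℂ}
    (hx : AlgebraicIndependent ℚ x) {g : MvPolynomial σ ℚ}
    (hg : MvPolynomial.aeval x g ∈
      (matroid ℚ ℂ).closure (Set.range fun e ↦ MvPolynomial.aeval x (f e)))
    {γ : unitInterval → σ → ℂ} (hγ : Continuous γ) (hγ0 : γ 0 = x)
    (hf : ∀ t e, MvPolynomial.aeval (γ t) (f e) = MvPolynomial.aeval x (f e)) (t : unitInterval) :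
    MvPolynomial.aeval (γ t) g = MvPolynomial.aeval x g := by
  rw [mem_closure_iff_isAlgebraic] at hg
  let a : E → ℂ := fun e ↦ MvPolynomial.aeval x (f e)
  obtain ⟨P, hP0, hP⟩ := hg
  have hsurj : ∀ b : Algebra.adjoin ℚ (Set.range a), ∃ q : MvPolynomial E ℚ,
      MvPolynomial.aeval a q = b := fun b ↦ by
    obtain ⟨b, hb⟩ := b
    rw [Algebra.adjoin_range_eq_range_aeval] at hb
    exact hb
  let S := Algebra.adjoin ℚ (Set.range a)
  let b : E → S := fun e ↦ ⟨a e, Algebra.subset_adjoin ⟨e, rfl⟩⟩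
  let φ : MvPolynomial E ℚ →+* S := (MvPolynomial.aeval b).toRingHom
  have hφ : ∀ q, (φ q : ℂ) = MvPolynomial.aeval a q := fun q ↦
    MvPolynomial.comp_aeval_apply b S.val q
  obtain ⟨Q, rfl⟩ := Polynomial.map_surjective φ (fun b ↦ by
    obtain ⟨q, hq⟩ := hsurj b
    exact ⟨q, Subtype.ext ((hφ q).trans hq)⟩) P
  -- `T` is the relation for `aeval x g` over `ℂ`; it is the same at all points where the values of
  -- `f` are as at `x`
  let T : Polynomial ℂ := Q.map (MvPolynomial.aeval a : MvPolynomial E ℚ →ₐ[ℚ] ℂ).toRingHom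
  have hT : ∀ z : σ → ℂ, (∀ e, MvPolynomial.aeval z (f e) = a e) →
      MvPolynomial.aeval z (Q.eval₂ (MvPolynomial.aeval f : MvPolynomial E ℚ →ₐ[ℚ] _).toRingHom g)
        = T.eval (MvPolynomial.aeval z g) := fun z hz ↦ by
    have := Polynomial.hom_eval₂ Q
      (MvPolynomial.aeval f : MvPolynomial E ℚ →ₐ[ℚ] MvPolynomial σ ℚ).toRingHom
      (MvPolynomial.aeval z : MvPolynomial σ ℚ →ₐ[ℚ] ℂ).toRingHom g
    refine this.trans ?_
    rw [Polynomial.eval_map]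
    congr 1
    ext e
    · simp
    · simp [hz]
  have hTQ : T = (Q.map φ).map (algebraMap S ℂ) := by
    have h : (MvPolynomial.aeval a : MvPolynomial E ℚ →ₐ[ℚ] ℂ).toRingHom =
        (algebraMap S ℂ).comp φ := RingHom.ext fun q ↦ (hφ q).symm
    rw [Polynomial.map_map, ← h]
  have hT0 : T ≠ 0 := by
    rw [hTQ]
    exact (Polynomial.map_ne_zero_iff Subtype.val_injective).2 hP0
  have hroot : T.eval (MvPolynomial.aeval x g) = 0 := by
    rw [hTQ, Polynomial.eval_map_algebraMap]; exact hP
  have hzero : Q.eval₂ (MvPolynomial.aeval f : MvPolynomial E ℚ →ₐ[ℚ] _).toRingHom g = 0 :=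
    hx.eq_zero_of_aeval_eq_zero _ ((hT x fun _ ↦ rfl).trans hroot)
  have hmem : ∀ t, MvPolynomial.aeval (γ t) g ∈ {z | z ∈ T.roots} := fun t ↦ by
    rw [Set.mem_ofPred_eq, Polynomial.mem_roots hT0, Polynomial.IsRoot, ← hT _ (hf t), hzero,
      map_zero]
  have hcont : Continuous fun t ↦ MvPolynomial.aeval (γ t) g := by
    have h : Continuous fun z : σ → ℂ ↦ MvPolynomial.aeval z g := by
      simpa only [MvPolynomial.aeval_def, MvPolynomial.eval₂_eq_eval_map] using
        MvPolynomial.continuous_eval (g.map (algebraMap ℚ ℂ))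
    exact h.comp hγ
  have hfin : (Set.range fun t ↦ MvPolynomial.aeval (γ t) g).Finite :=
    (Set.Finite.ofFinset T.roots.toFinset (by simp)).subset (Set.range_subset_iff.2 hmem)
  by_contra hne
  refine (isPreconnected_range hcont).infinite_of_nontrivial ⟨_, ⟨t, rfl⟩, _, ⟨0, rfl⟩, ?_⟩ hfin
  simpa [hγ0] using hne

/-- The converse of `aeval_path_constant`. Independent values at a generic point force the
derivatives to be independent, as derivations of `ℂ` with arbitrary values on them exist. -/
theorem mem_closure_of_forall_path {σ E : Type*} [Finite σ] [Finite E]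
    {f : E → MvPolynomial σ ℚ} {x : σ → ℂ} (hx : AlgebraicIndependent ℚ x) {g : MvPolynomial σ ℚ}
    (H : ∀ γ : unitInterval → σ → ℂ, Continuous γ → γ 0 = x →
      (∀ t e, MvPolynomial.aeval (γ t) (f e) = MvPolynomial.aeval x (f e)) →
        ∀ t, MvPolynomial.aeval (γ t) g = MvPolynomial.aeval x g) :
    MvPolynomial.aeval x g ∈
      (matroid ℚ ℂ).closure (Set.range fun e ↦ MvPolynomial.aeval x (f e)) := by
  classical
  have := Fintype.ofFinite σ
  by_contra hg
  set M := matroid ℚ ℂ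
  obtain ⟨I, hI⟩ := M.exists_isBasis (Set.range fun e ↦ MvPolynomial.aeval x (f e))
  have hIfin : I.Finite := (Set.finite_range _).subset hI.subset
  have := hIfin.fintype
  rw [← hI.closure_eq_closure] at hg
  have hgI : MvPolynomial.aeval x g ∉ I := fun h ↦ hg (M.mem_closure_of_mem h)
  choose e he using fun i : I ↦ hI.subset i.2
  simp only at he
  have hind : AlgebraicIndependent ℚ
      fun o : Option I ↦ o.elim (MvPolynomial.aeval x g) fun i ↦ (i : ℂ) := by
    have h1 : AlgebraicIndependent ℚ fun i : I ↦ (i : ℂ) :=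
      AlgebraicIndependent.matroid_indep_iff.1 hI.indep
    have hrange : (Set.range fun i : I ↦ (i : ℂ)) = I := Subtype.range_coe
    rw [h1.option_iff_transcendental, hrange]
    rw [mem_closure_iff_isAlgebraic] at hg
    exact hg
  let h : Option I → MvPolynomial σ ℚ := fun o ↦ o.elim g fun i ↦ f (e i)
  have hh : ∀ o, MvPolynomial.aeval x (h o) = o.elim (MvPolynomial.aeval x g) fun i ↦ (i : ℂ) := by
    rintro (_ | i)
    · rfl
    · exact he i
  let h' : (σ → ℂ) →L[ℂ] (Option I → ℂ) := .pi fun o ↦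
    ∑ i, MvPolynomial.aeval x (MvPolynomial.pderiv i (h o)) •
        ContinuousLinearMap.proj (R := ℂ) (φ := fun _ : σ ↦ ℂ) i
  have hder : HasStrictFDerivAt (fun z o ↦ MvPolynomial.aeval z (h o)) h' x :=
    hasStrictFDerivAt_pi.2 fun o ↦ hasStrictFDerivAt_aeval (h o) x
  have hsurj : Function.Surjective h' := fun w ↦ by
    obtain ⟨D, hD⟩ := exists_derivation_of_algebraicIndependent hind w
    refine ⟨fun i ↦ D (x i), funext fun o ↦ ?_⟩
    rw [← hD o, ← hh, derivation_aeval]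
    simp [h']
  obtain ⟨γ, hγ, hγ0, r, hr, hγr⟩ := exists_path_of_surjective_deriv hder hsurj (Pi.single none 1)
  have hconst : ∀ t e, MvPolynomial.aeval (γ t) (f e) = MvPolynomial.aeval x (f e) := fun t j ↦ by
    refine aeval_path_constant (f := fun i : I ↦ f (e i)) hx ?_ hγ hγ0 (fun t i ↦ ?_) t
    · have : (Set.range fun i : I ↦ MvPolynomial.aeval x (f (e i))) = I := by
        simp [he]
      rw [this]
      exact hI.subset_closure ⟨j, rfl⟩
    · simpa [h] using congrFun (hγr t) (some i)
  have h1 := congrFun (hγr 1) none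
  have h2 := H γ hγ hγ0 hconst 1
  simp [h, h2, hr] at h1

/-! ### Squared lengths in generic frameworks -/

section Lengths

variable {V W : Type*} {d : ℕ}

theorem sqLength_map (p : Config W d) (f : V → W) (e : Sym2 V) :
    sqLength p (e.map f) = sqLength (p ∘ f) e := by
  induction e with | _ u v => rfl

theorem Generic.comp {p : Config W d} (hp : Generic p) {f : V → W} (hf : Function.Injective f) :
    Generic (p ∘ f) :=
  AlgebraicIndependent.comp hp (Prod.map f id) (hf.prodMap Function.injective_id)

/-- The squared length of a pair of vertices as a polynomial in the coordinates of the vertices. -/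
noncomputable def sqLengthPoly (d : ℕ) (e : Sym2 V) : MvPolynomial (V × Fin d) ℚ :=
  e.lift ⟨fun u v ↦ ∑ k, (.X (u, k) - .X (v, k)) ^ 2, fun _ _ ↦
    Finset.sum_congr rfl fun _ _ ↦ by ring⟩

theorem aeval_sqLengthPoly (x : V × Fin d → ℂ) (e : Sym2 V) :
    MvPolynomial.aeval x (sqLengthPoly d e) = sqLength (fun v k ↦ x (v, k)) e := by
  induction e with | _ u v => simp [sqLengthPoly, sqLength]

/-- The squared lengths of all pairs of vertices in `s`, in the configuration `p`. Pairs of equal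
vertices are included and contribute only `0`. -/
def pairLengths (p : Config V d) (s : Set V) : Set ℂ :=
  Set.image2 (fun u v ↦ sqLength p s(u, v)) s s

theorem pairLengths_image (p : Config W d) (f : V → W) (s : Set V) :
    pairLengths p (f '' s) = pairLengths (p ∘ f) s := by
  simp only [pairLengths, Set.image2_image_left, Set.image2_image_right]; rfl

theorem pairLengths_mono (p : Config V d) {s t : Set V} (h : s ⊆ t) :
    pairLengths p s ⊆ pairLengths p t :=
  Set.image2_subset h h

/-- In a rigid generic framework all squared lengths are algebraic over those of the edges. -/
theorem FrameworkRigid.pairLengths_subset [Finite V] {G : SimpleGraph V} {p : Config V d}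
    (hr : FrameworkRigid G p) (hp : Generic p) :
    pairLengths p Set.univ ⊆ (matroid ℚ ℂ).closure (sqLength p '' G.edgeSet) := by
  rintro _ ⟨u, -, v, -, rfl⟩
  rcases eq_or_ne u v with rfl | huv
  · have : sqLength p s(u, u) = 0 := by simp [sqLength]
    simp only [this]
    rw [mem_closure_iff_isAlgebraic]
    exact isAlgebraic_zero
  have := mem_closure_of_forall_path (f := fun e : G.edgeSet ↦ sqLengthPoly d (e : Sym2 V))
    (g := sqLengthPoly d s(u, v)) hp fun γ hγ hγ0 hγe t ↦ by
      simp only [aeval_sqLengthPoly] at hγe ⊢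
      exact (hr (fun t v k ↦ γ t (v, k)) (by fun_prop) (by simp [hγ0])
        (fun t e he ↦ (hγe t ⟨e, he⟩).symm) t s(u, v) (by simpa using huv)).symm
  simp only [aeval_sqLengthPoly] at this
  rwa [Set.image_eq_range]

theorem derivation_sqLength (D : Derivation ℚ ℂ ℂ) (p : Config V d) (u v : V) :
    D (sqLength p s(u, v)) = 2 * ((p u - p v) ⬝ᵥ ((D ∘ p u) - (D ∘ p v))) := by
  simp [sqLength, Derivation.leibniz_pow, dotProduct, Finset.mul_sum]

/-- The coordinates of a generic configuration can be given arbitrary velocities by a derivation. -/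
theorem Generic.exists_derivation {p : Config V d} (hp : Generic p) (w : V → Fin d → ℂ) :
    ∃ D : Derivation ℚ ℂ ℂ, ∀ v, D ∘ p v = w v := by
  obtain ⟨D, hD⟩ := exists_derivation_of_algebraicIndependent hp fun x ↦ w x.1 x.2
  exact ⟨D, fun v ↦ funext fun k ↦ hD (v, k)⟩

theorem Generic.det_ne_zero {p : Config V d} (hp : Generic p) {κ : Type*} [Fintype κ]
    [DecidableEq κ] {a : κ → V} (ha : Function.Injective a) {v₀ : V} (hv₀ : ∀ i, a i ≠ v₀)
    {g : κ → Fin d} (hg : Function.Injective g) :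
    (Matrix.of fun i j ↦ (p (a i) - p v₀) (g j)).det ≠ 0 := by
  classical
  let M : Matrix κ κ (MvPolynomial (V × Fin d) ℚ) := .of fun i j ↦ .X (a i, g j) - .X (v₀, g j)
  have hM : ∀ x : V × Fin d → ℂ, MvPolynomial.aeval x M.det =
      (Matrix.of fun i j ↦ x (a i, g j) - x (v₀, g j)).det := fun x ↦ by
    rw [AlgHom.map_det]
    congr 1
    ext i j
    simp [M]
  have hM0 : M.det ≠ 0 := fun h0 ↦ by
    -- this substitution puts `v₀` at the origin and `a i` at the basis vector with index `g i`
    have h := hM fun x ↦ if ∃ i, a i = x.1 ∧ g i = x.2 then 1 else 0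
    have h1 : (Matrix.of fun i j ↦ (if ∃ l, a l = a i ∧ g l = g j then (1 : ℂ) else 0) -
        if ∃ l, a l = v₀ ∧ g l = g j then 1 else 0) = 1 := by
      ext i j
      simp [ha.eq_iff, hg.eq_iff, hv₀, Matrix.one_apply]
    simp only [h0, h1, map_zero, Matrix.det_one] at h
    exact zero_ne_one h
  intro h
  exact hM0 (hp.eq_zero_of_aeval_eq_zero _ ((hM _).trans h))

/-- Generic points are in general position: their differences with one of them are linearly
independent if there are few points, and span the space if there are many. -/
theorem Generic.linearIndependent_or_span_eq_top [Finite V] {p : Config V d} (hp : Generic p)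
    {κ : Type*} [Finite κ] {a : κ → V} (ha : Function.Injective a) {v₀ : V}
    (hv₀ : ∀ i, a i ≠ v₀) :
    LinearIndependent ℂ (fun i ↦ p (a i) - p v₀) ∨
      Submodule.span ℂ (Set.range fun i ↦ p (a i) - p v₀) = ⊤ := by
  classical
  have := Fintype.ofFinite κ
  rcases le_total (Fintype.card κ) (Fintype.card (Fin d)) with h | h
  · left
    obtain ⟨g⟩ := Function.Embedding.nonempty_of_card_le h
    have := Matrix.linearIndependent_rows_of_det_ne_zero (hp.det_ne_zero ha hv₀ g.injective)
    exact LinearIndependent.of_comp (LinearMap.funLeft ℂ ℂ g) this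
  · right
    obtain ⟨h⟩ := Function.Embedding.nonempty_of_card_le h
    have := Matrix.linearIndependent_rows_of_det_ne_zero
      (hp.det_ne_zero (ha.comp h.injective) (fun i ↦ hv₀ _) Function.injective_id)
    refine top_le_iff.1 ((this.span_eq_top_of_card_eq_finrank' (by simp)).ge.trans
      (Submodule.span_mono ?_))
    rintro _ ⟨i, rfl⟩
    exact ⟨h i, rfl⟩

/-- A derivation that kills all squared lengths between generic points moves these points by an
infinitesimal isometry. -/
theorem Generic.exists_skew_of_derivation [Finite V] {p : Config V d} (hp : Generic p) {s : Set V}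
    {v₀ : V} (hv₀ : v₀ ∈ s) {D : Derivation ℚ ℂ ℂ} (hD : ∀ b ∈ pairLengths p s, D b = 0) :
    ∃ A : Matrix (Fin d) (Fin d) ℂ, (∀ x, x ⬝ᵥ A.mulVec x = 0) ∧
      ∀ v ∈ s, A.mulVec (p v - p v₀) = D ∘ p v - D ∘ p v₀ := by
  have horth : ∀ u ∈ s, ∀ v ∈ s, (p u - p v) ⬝ᵥ (D ∘ p u - D ∘ p v) = 0 := fun u hu v hv ↦ by
    have := hD _ ⟨u, hu, v, hv, rfl⟩
    rw [derivation_sqLength] at this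
    exact (mul_eq_zero.1 this).resolve_left two_ne_zero
  obtain ⟨A, hA, hAu⟩ := exists_skew_map (fun v : {v : V // v ∈ s ∧ v ≠ v₀} ↦ p v - p v₀)
    (fun v ↦ D ∘ p v - D ∘ p v₀) (fun u v ↦ by
      have h1 := horth u u.2.1 v v.2.1
      have h2 := horth u u.2.1 v₀ hv₀
      have h3 := horth v v.2.1 v₀ hv₀
      rw [dotProduct_comm (_ - _ : Fin d → ℂ) (p v - p v₀)]
      simp only [sub_dotProduct, dotProduct_sub] at h1 h2 h3 ⊢
      linear_combination h2 + h3 - h1)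
    (hp.linearIndependent_or_span_eq_top Subtype.val_injective fun v ↦ v.2.2)
  refine ⟨A, hA, fun v hv ↦ ?_⟩
  rcases eq_or_ne v v₀ with rfl | hne
  · simp
  · exact hAu ⟨v, hv, hne⟩

/-- What the lengths in `s` and the lengths in `t` both determine, up to finitely many values, is
determined by the lengths in `s ∩ t`. -/
theorem Generic.closure_pairLengths_inter_subset [Finite V] {p : Config V d} (hp : Generic p)
    {s t : Set V} (hne : (s ∩ t).Nonempty) :
    (matroid ℚ ℂ).closure (pairLengths p s) ∩ (matroid ℚ ℂ).closure (pairLengths p t) ⊆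
      (matroid ℚ ℂ).closure (pairLengths p (s ∩ t)) := by
  classical
  rintro y ⟨hys, hyt⟩
  by_contra hy
  obtain ⟨D, hD, hDy⟩ := exists_derivation_of_notMem_closure hy
  obtain ⟨v₀, hv₀⟩ := hne
  obtain ⟨A, hA, hAv⟩ := hp.exists_skew_of_derivation hv₀ hD
  -- `D'` is an infinitesimal isometry on `s` and agrees with `D` on `t`; the two prescriptions are
  -- compatible on `s ∩ t`
  obtain ⟨D', hD'⟩ := hp.exists_derivation fun v ↦
    if v ∈ s then A.mulVec (p v - p v₀) + D ∘ p v₀ else D ∘ p v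
  have h1 : D' y = 0 := by
    refine derivation_eq_zero_of_mem_closure D' ?_ hys
    rintro _ ⟨u, hu, v, hv, rfl⟩
    rw [derivation_sqLength, hD', hD', if_pos hu, if_pos hv, add_sub_add_right_eq_sub,
      ← Matrix.mulVec_sub, sub_sub_sub_cancel_right, hA, mul_zero]
  have hDD' : ∀ v ∈ t, D' ∘ p v = D ∘ p v := fun v hv ↦ by
    rw [hD']
    split_ifs with h
    · rw [hAv v ⟨h, hv⟩, sub_add_cancel]
    · rfl
  have h2 : (D - D') y = 0 := by
    refine derivation_eq_zero_of_mem_closure (D - D') ?_ hyt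
    rintro _ ⟨u, hu, v, hv, rfl⟩
    rw [Derivation.sub_apply, derivation_sqLength, derivation_sqLength, hDD' u hu, hDD' v hv,
      sub_self]
  rw [Derivation.sub_apply, h1, sub_zero] at h2
  exact hDy h2

/-- The distance from a generic point outside `s` to a point of `s` is not algebraic over the
lengths in `s`: this is where `d ≥ 1` matters. -/
theorem Generic.sqLength_notMem_closure (hd : 1 ≤ d) {q : Config W d} (hq : Generic q) {s : Set W}
    {w w₀ : W} (hw : w ∉ s) (hw₀ : w₀ ∈ s) :
    sqLength q s(w, w₀) ∉ (matroid ℚ ℂ).closure (pairLengths q s) := fun h ↦ by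
  classical
  have hne : w ≠ w₀ := fun h ↦ hw (h ▸ hw₀)
  let k : Fin d := ⟨0, hd⟩
  obtain ⟨D, hD⟩ := hq.exists_derivation fun v ↦ if v = w then Pi.single k 1 else 0
  have h0 : ∀ v ∈ s, D ∘ q v = 0 := fun v hv ↦ by
    rw [hD, if_neg (ne_of_mem_of_not_mem hv hw)]
  have := derivation_eq_zero_of_mem_closure D (fun b hb ↦ by
    obtain ⟨u, hu, v, hv, rfl⟩ := hb
    simp only [derivation_sqLength, h0 u hu, h0 v hv, sub_zero, dotProduct_zero, mul_zero]) h
  rw [derivation_sqLength, hD, if_pos rfl, h0 w₀ hw₀, sub_zero, dotProduct_single, mul_one] at this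
  have heq : q w k = q w₀ k := sub_eq_zero.1 ((mul_eq_zero.1 this).resolve_left two_ne_zero)
  exact hne (congrArg Prod.fst
    (AlgebraicIndependent.injective hq (a₁ := (w, k)) (a₂ := (w₀, k)) heq))

theorem eRk_pairLengths_le {p : Config V d} {q : Config W d} (hq : Generic q)
    {φ : V → W} {s : Set V} (hφ : s.InjOn φ) :
    (matroid ℚ ℂ).eRk (pairLengths p s) ≤ (matroid ℚ ℂ).eRk (pairLengths q (φ '' s)) := by
  have h : ∀ r : Config V d, pairLengths r s = Set.range fun e : s × s ↦
      MvPolynomial.aeval (fun x : s × Fin d ↦ r x.1 x.2) (sqLengthPoly d s(e.1, e.2)) := fun r ↦ by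
    ext a
    simp only [aeval_sqLengthPoly]
    constructor
    · rintro ⟨u, hu, v, hv, rfl⟩; exact ⟨(⟨u, hu⟩, ⟨v, hv⟩), rfl⟩
    · rintro ⟨⟨u, v⟩, rfl⟩; exact ⟨u, u.2, v, v.2, rfl⟩
  rw [pairLengths_image, h, h]
  exact eRk_range_aeval_le _ (hq.comp (f := fun v : s ↦ φ v) hφ.injective)

/-- A map that is injective on two vertex sets with a common vertex is injective on their union, if
the lengths among the images of either set are algebraic over the lengths in that set. -/
theorem Generic.injective_of_injOn [Finite V] (hd : 1 ≤ d) {p : Config V d} {q : Config W d}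
    (hp : Generic p) (hq : Generic q) {s t : Set V} (hst : s ∪ t = Set.univ)
    (hne : (s ∩ t).Nonempty) {φ : V → W} (hs : s.InjOn φ) (ht : t.InjOn φ)
    (hqs : pairLengths q (φ '' s) ⊆ (matroid ℚ ℂ).closure (pairLengths p s))
    (hqt : pairLengths q (φ '' t) ⊆ (matroid ℚ ℂ).closure (pairLengths p t)) :
    Function.Injective φ := by
  -- points of `s` and `t` with the same image lie in `s ∩ t`, by comparing ranks
  have key : ∀ u ∈ s, ∀ v ∈ t, φ u = φ v → u ∈ t := fun u hu v hv huv ↦ by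
    by_contra hut
    obtain ⟨v₀, hv₀⟩ := hne
    have hw : φ u ∉ φ '' (s ∩ t) := by
      rintro ⟨x, hx, hxu⟩
      exact hut (hs hx.1 hu hxu ▸ hx.2)
    set M := matroid ℚ ℂ
    have hx := hq.sqLength_notMem_closure hd hw ⟨v₀, hv₀, rfl⟩
    have hsub : insert (sqLength q s(φ u, φ v₀)) (pairLengths q (φ '' (s ∩ t))) ⊆
        M.closure (pairLengths p (s ∩ t)) := by
      refine Set.Subset.trans ?_ (hp.closure_pairLengths_inter_subset ⟨v₀, hv₀⟩)
      refine Set.insert_subset ⟨hqs ⟨_, ⟨u, hu, rfl⟩, _, ⟨v₀, hv₀.1, rfl⟩, rfl⟩,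
        hqt ⟨_, ⟨v, hv, rfl⟩, _, ⟨v₀, hv₀.2, rfl⟩, by simp only [huv]⟩⟩
        (Set.subset_inter ?_ ?_)
      · exact (pairLengths_mono q (Set.image_mono Set.inter_subset_left)).trans hqs
      · exact (pairLengths_mono q (Set.image_mono Set.inter_subset_right)).trans hqt
    have hle := M.eRk_mono hsub
    rw [M.eRk_closure_eq, M.eRk_insert_eq_add_one ⟨trivial, hx⟩] at hle
    have hfin : M.eRk (pairLengths q (φ '' (s ∩ t))) ≠ ⊤ := by
      have : (pairLengths q (φ '' (s ∩ t))).Finite :=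
        ((Set.toFinite _).image φ).image2 _ ((Set.toFinite _).image φ)
      exact ((M.eRk_le_encard _).trans_lt this.encard_lt_top).ne
    have := hle.trans (eRk_pairLengths_le (p := p) hq (hs.mono Set.inter_subset_left))
    exact (ENat.add_one_le_iff hfin).1 this |>.false
  intro u v huv
  have hu : u ∈ s ∪ t := hst ▸ trivial
  have hv : v ∈ s ∪ t := hst ▸ trivial
  rcases hu with hu | hu <;> rcases hv with hv | hv
  · exact hs hu hv huv
  · exact ht (key u hu v hv huv) hv huv
  · exact ht hu (key v hv u hu huv.symm) huv
  · exact ht hu hv huv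

end Lengths

/-! ### Gluing the reconstructions of two subgraphs -/

/-- In a connected graph on at least three vertices, every edge meets another edge, so the vertex
map is determined by the images of the edges. -/
theorem eq_of_forall_adj_sym2_eq {S W : Type*} {K : SimpleGraph S} (hK : K.Preconnected)
    (hS : 3 ≤ Nat.card S) {f g : S → W} (hg : Function.Injective g)
    (h : ∀ u v, K.Adj u v → s(f u, f v) = s(g u, g v)) : f = g := by
  classical
  have : Finite S := Nat.finite_of_card_ne_zero (by lia)
  have : Nontrivial S := Finite.one_lt_card_iff_nontrivial.1 (by lia)
  funext u
  obtain ⟨v, huv⟩ := hK.exists_adj_of_nontrivial u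
  obtain ⟨z, hz⟩ : ∃ z, z ∉ ({u, v} : Set S) := by
    by_contra! hall
    have : Nat.card S ≤ ({u, v} : Set S).ncard := by
      rw [← Set.ncard_univ]
      exact Set.ncard_le_ncard (fun z _ ↦ hall z)
    have := Set.ncard_insert_le u {v}
    rw [Set.ncard_singleton] at this
    lia
  -- an edge `ab` that leaves `{u, v}` tells `u` and `v` apart
  obtain ⟨P⟩ := hK u z
  obtain ⟨⟨⟨a, b⟩, hab⟩, -, ha, hb⟩ := P.exists_boundary_dart {u, v} (by simp) hz
  have h1 := h u v huv
  have h2 := h a b hab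
  simp only [Set.mem_insert_iff, Set.mem_singleton_iff, not_or] at ha hb
  rw [Sym2.eq_iff] at h1 h2
  have hbu := hg.ne hb.1
  have hbv := hg.ne hb.2
  have hguv := hg.ne huv.ne
  rcases ha with rfl | rfl <;> grind

/-- Full reconstructibility of a subgraph of `G`, applied to the subgraph of `H` that consists of
the images of its edges under `ψ`. -/
theorem exists_map_of_subgraph {V : Type*} {W : Type} [Finite W] {d : ℕ} {G : SimpleGraph V}
    {H : SimpleGraph W} {p : Config V d} {q : Config W d} (hp : Generic p) (hq : Generic q)
    (ψ : G.edgeSet ≃ H.edgeSet) (hψ : LengthEquivalent p q ψ) (K : G.Subgraph)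
    (hK : FullyReconstructible d K.coe) :
    ∃ φ : K.verts → W, Function.Injective φ ∧
      ∀ u v (h : K.Adj u v), (ψ ⟨s(u, v), h.adj_sub⟩ : Sym2 W) =
        s(φ ⟨u, h.fst_mem⟩, φ ⟨v, h.snd_mem⟩) := by
  let W' : Set W := {w | ∃ e : G.edgeSet, (e : Sym2 V) ∈ K.edgeSet ∧ w ∈ (ψ e : Sym2 W)}
  let H' : SimpleGraph W' :=
    { Adj := fun a b ↦ ∃ e : G.edgeSet, (e : Sym2 V) ∈ K.edgeSet ∧ (ψ e : Sym2 W) = s(a.1, b.1)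
      symm := ⟨fun a b ⟨e, he, hab⟩ ↦ ⟨e, he, hab.trans Sym2.eq_swap⟩⟩
      loopless := ⟨fun a ⟨e, _, hab⟩ ↦ by
        have := (ψ e).2
        rw [hab] at this
        exact H.loopless.irrefl _ this⟩ }
  have hedge : ∀ e : K.coe.edgeSet, (e : Sym2 K.verts).map Subtype.val ∈ K.edgeSet := by
    rintro ⟨e, he⟩
    induction e with | _ u v => exact he
  let ι : K.coe.edgeSet → G.edgeSet := fun e ↦
    ⟨(e : Sym2 K.verts).map Subtype.val, K.edgeSet_subset (hedge e)⟩
  have hex : ∀ e : K.coe.edgeSet, ∃ e' : H'.edgeSet,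
      (e' : Sym2 W').map Subtype.val = (ψ (ι e) : Sym2 W) := fun e ↦ by
    obtain ⟨a, b, hab⟩ : ∃ a b, (ψ (ι e) : Sym2 W) = s(a, b) := by
      induction h : (ψ (ι e) : Sym2 W) with | _ a b => exact ⟨a, b, rfl⟩
    exact ⟨⟨s(⟨a, ι e, hedge e, by simp [hab]⟩, ⟨b, ι e, hedge e, by simp [hab]⟩),
      ι e, hedge e, hab⟩, hab.symm⟩
  -- `τ` is the restriction of `ψ` to the edges of `K`, with values in the edges of `H'`
  choose τ hτ using hex
  have hval : Function.Injective (Sym2.map (Subtype.val : K.verts → V)) :=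
    Sym2.map.injective Subtype.val_injective
  have hval' : Function.Injective (Sym2.map (Subtype.val : W' → W)) :=
    Sym2.map.injective Subtype.val_injective
  have hbij : Function.Bijective τ := by
    constructor
    · intro e e' hee
      have : ι e = ι e' := ψ.injective (Subtype.ext (by rw [← hτ, ← hτ, hee]))
      exact Subtype.ext (hval (congrArg Subtype.val this))
    · rintro ⟨e', he'⟩
      induction e' with
      | _ a b =>
      obtain ⟨⟨e, heG⟩, heK, hab⟩ := he'
      induction e with
      | _ u v =>
      have huv : K.Adj u v := heK
      refine ⟨⟨s(⟨u, huv.fst_mem⟩, ⟨v, huv.snd_mem⟩), huv⟩, Subtype.ext (hval' ?_)⟩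
      rw [hτ]
      exact hab
  let ψ' : K.coe.edgeSet ≃ H'.edgeSet := .ofBijective τ hbij
  have hiso : NoIsolated H' := by
    rintro ⟨w, e, he, hw⟩ hiso
    obtain ⟨b, hb⟩ := Sym2.mem_iff_exists.1 hw
    exact hiso ⟨b, e, he, by simp [hb]⟩ ⟨e, he, hb⟩
  obtain ⟨φ, hφ⟩ := hK.2 (p ∘ Subtype.val) (hp.comp Subtype.val_injective) W' H'
    (q ∘ Subtype.val) ψ' hiso (hq.comp Subtype.val_injective) fun e ↦ by
      rw [← sqLength_map, ← sqLength_map]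
      exact (hψ (ι e)).trans (congrArg (sqLength q) (hτ e).symm)
  refine ⟨fun v ↦ φ v, Subtype.val_injective.comp φ.injective, fun u v h ↦ ?_⟩
  let e : K.coe.edgeSet := ⟨s(⟨u, h.fst_mem⟩, ⟨v, h.snd_mem⟩), h⟩
  have := congrArg (fun x : H'.edgeSet ↦ (x : Sym2 W').map Subtype.val) (hφ e)
  exact (hτ e).symm.trans this

/-- Rigidity of `K` is applied to the configuration `q ∘ φ`, whose edge lengths are those of `p`. -/
theorem pairLengths_subset_of_rigid {V W : Type*} [Finite V] {d : ℕ} {G : SimpleGraph V}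
    {H : SimpleGraph W} {p : Config V d} {q : Config W d} (hq : Generic q)
    {ψ : G.edgeSet ≃ H.edgeSet} (hψ : LengthEquivalent p q ψ) {K : G.Subgraph}
    (hK : Rigid d K.coe) {φ : K.verts → W} (hφ : Function.Injective φ)
    (hφψ : ∀ u v (h : K.Adj u v), (ψ ⟨s(u, v), h.adj_sub⟩ : Sym2 W) =
      s(φ ⟨u, h.fst_mem⟩, φ ⟨v, h.snd_mem⟩)) :
    pairLengths q (Set.range φ) ⊆ (matroid ℚ ℂ).closure (pairLengths p K.verts) := by
  have hg := hq.comp hφ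
  rw [← Set.image_univ, pairLengths_image]
  refine ((hK _ hg).pairLengths_subset hg).trans ((matroid ℚ ℂ).closure_subset_closure ?_)
  rintro _ ⟨e, he, rfl⟩
  induction e with
  | _ u v =>
  have h : K.Adj u v := he
  refine ⟨u, u.2, v, v.2, ?_⟩
  exact (hψ ⟨s((u : V), v), h.adj_sub⟩).trans (congrArg (sqLength q) (hφψ u v h))

end Rigidity

theorem theorem4p6 {V : Type*} [Finite V] (d : ℕ) (hd : 1 ≤ d) (G : SimpleGraph V)
    (G₁ G₂ : G.Subgraph) (hind₁ : G₁.IsInduced) (hind₂ : G₂.IsInduced) (hunion : G₁ ⊔ G₂ = ⊤)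
    (hconn : (G.induce (G₁.verts ∩ G₂.verts)).Connected)
    (hthree : 3 ≤ (G₁.verts ∩ G₂.verts).ncard)
    (hcard₁ : d + 1 ≤ G₁.verts.ncard) (hcard₂ : d + 1 ≤ G₂.verts.ncard)
    (hrigid₁ : Rigidity.Rigid d G₁.coe) (hrigid₂ : Rigidity.Rigid d G₂.coe)
    (hrec₁ : Rigidity.FullyReconstructible d G₁.coe)
    (hrec₂ : Rigidity.FullyReconstructible d G₂.coe) :
    Rigidity.FullyReconstructible d G := by
  classical
  have hverts : G₁.verts ∪ G₂.verts = Set.univ := by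
    rw [← SimpleGraph.Subgraph.verts_sup, hunion, SimpleGraph.Subgraph.verts_top]
  have hadj : ∀ u v, G.Adj u v → G₁.Adj u v ∨ G₂.Adj u v := fun u v h ↦ by
    rw [← SimpleGraph.Subgraph.sup_adj, hunion]; exact h
  refine ⟨fun v hv ↦ ?_, fun p hp W _ H q ψ hH hq hψ ↦ ?_⟩
  · rcases (hverts ▸ trivial : v ∈ G₁.verts ∪ G₂.verts) with h | h
    · exact hrec₁.1 ⟨v, h⟩ fun u hu ↦ hv u hu.adj_sub
    · exact hrec₂.1 ⟨v, h⟩ fun u hu ↦ hv u hu.adj_sub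
  obtain ⟨φ₁, hφ₁, hψ₁⟩ := Rigidity.exists_map_of_subgraph hp hq ψ hψ G₁ hrec₁
  obtain ⟨φ₂, hφ₂, hψ₂⟩ := Rigidity.exists_map_of_subgraph hp hq ψ hψ G₂ hrec₂
  have hagree : ∀ v (h₁ : v ∈ G₁.verts) (h₂ : v ∈ G₂.verts), φ₁ ⟨v, h₁⟩ = φ₂ ⟨v, h₂⟩ := by
    have := Rigidity.eq_of_forall_adj_sym2_eq hconn.preconnected hthree
      (f := fun v ↦ φ₁ ⟨v, v.2.1⟩) (g := fun v ↦ φ₂ ⟨v, v.2.2⟩)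
      (fun u v huv ↦ Subtype.ext (congrArg Subtype.val (hφ₂ huv) :))
      (fun u v (huv : G.Adj u v) ↦ (hψ₁ u v (hind₁ u.2.1 v.2.1 huv)).symm.trans
        (hψ₂ u v (hind₂ u.2.2 v.2.2 huv)))
    exact fun v h₁ h₂ ↦ congrFun this ⟨v, h₁, h₂⟩
  have hmem₂ : ∀ v, v ∉ G₁.verts → v ∈ G₂.verts := fun v hv ↦
    (hverts ▸ trivial : v ∈ G₁.verts ∪ G₂.verts).resolve_left hv
  let φ : V → W := fun v ↦ if h : v ∈ G₁.verts then φ₁ ⟨v, h⟩ else φ₂ ⟨v, hmem₂ v h⟩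
  have e₁ : ∀ v (h : v ∈ G₁.verts), φ v = φ₁ ⟨v, h⟩ := fun v h ↦ dif_pos h
  have e₂ : ∀ v (h : v ∈ G₂.verts), φ v = φ₂ ⟨v, h⟩ := fun v h ↦ by
    by_cases h₁ : v ∈ G₁.verts
    · rw [e₁ v h₁, hagree v h₁ h]
    · exact dif_neg h₁
  have hφψ : ∀ u v (h : G.Adj u v), (ψ ⟨s(u, v), h⟩ : Sym2 W) = s(φ u, φ v) := fun u v h ↦ by
    rcases hadj u v h with h' | h'
    · rw [e₁ u h'.fst_mem, e₁ v h'.snd_mem]; exact hψ₁ u v h'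
    · rw [e₂ u h'.fst_mem, e₂ v h'.snd_mem]; exact hψ₂ u v h'
  have himg₁ : φ '' G₁.verts = Set.range φ₁ := by
    rw [Set.image_eq_range]; exact congrArg Set.range (funext fun v ↦ e₁ v v.2)
  have himg₂ : φ '' G₂.verts = Set.range φ₂ := by
    rw [Set.image_eq_range]; exact congrArg Set.range (funext fun v ↦ e₂ v v.2)
  have hinj : Function.Injective φ := hp.injective_of_injOn hd hq hverts
    (Set.nonempty_of_ncard_ne_zero (by lia))
    (fun u hu v hv h ↦ by
      rw [e₁ u hu, e₁ v hv] at h; exact congrArg Subtype.val (hφ₁ h))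
    (fun u hu v hv h ↦ by
      rw [e₂ u hu, e₂ v hv] at h; exact congrArg Subtype.val (hφ₂ h))
    (himg₁ ▸ Rigidity.pairLengths_subset_of_rigid hq hψ hrigid₁ hφ₁ hψ₁)
    (himg₂ ▸ Rigidity.pairLengths_subset_of_rigid hq hψ hrigid₂ hφ₂ hψ₂)
  have hpre : ∀ a b, H.Adj a b → ∃ u v, G.Adj u v ∧ s(φ u, φ v) = s(a, b) := fun a b hab ↦ by
    obtain ⟨⟨e, he⟩, heq⟩ := ψ.surjective ⟨s(a, b), hab⟩
    induction e with
    | _ u v => exact ⟨u, v, he, (hφψ u v he).symm.trans (congrArg Subtype.val heq)⟩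
  have hsurj : Function.Surjective φ := fun w ↦ by
    obtain ⟨b, hb⟩ : ∃ b, H.Adj w b := by
      by_contra! h; exact hH w fun b hb ↦ h b hb
    obtain ⟨u, v, -, huv⟩ := hpre w b hb
    rcases Sym2.eq_iff.1 huv with ⟨h, -⟩ | ⟨-, h⟩
    exacts [⟨u, h⟩, ⟨v, h⟩]
  let Φ : G ≃g H :=
    { Equiv.ofBijective φ ⟨hinj, hsurj⟩ with
      map_rel_iff' := fun {u v} ↦ by
        constructor
        · intro h
          obtain ⟨a, b, hab, heq⟩ := hpre _ _ h
          have : s(a, b) = s(u, v) := Sym2.map.injective hinj heq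
          rw [← SimpleGraph.mem_edgeSet, ← this]; exact hab
        · intro h
          have := (ψ ⟨s(u, v), h⟩).2
          rw [hφψ] at this
          exact this }
  refine ⟨Φ, ?_⟩
  rintro ⟨e, he⟩
  induction e with
  | _ u v => exact Subtype.ext (hφψ u v he)
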